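/- **Notation.** On a chessboard of height $2h+1$ and width $2w+1$ whose corner squares are black, the Aztec rectangle $AR_{h,w}$ consists of the white squares and the odd Aztec rectangle $O_{h,w}$ of the black squares ($h,w\ge 0$). Two squares of the same colour are neighbours if they share a corner; this makes a set $X$ of squares of one colour into a region of the (rotated) square lattice, and also into a graph. A domino tiling of $X$ is a partition of $X$ into pairs of neighbours. We write $\mathrm M(X)$ for the number of domino tilings of a region, and for the number of perfect matchings of a graph. The cruciform region $C_{p,q}^{u,v,u',v'}$ is obtained from a board (the core) of height $2q+1$ and width $2p+1$ by attaching to its top, right, bottom and left sides rectangular arms that have the same width as these sides and lengths $2u+1$, $2v+1$, $2u'+1$, $2v'+1$, and taking all the squares of the resulting cross that have the colour of the corners of the core. **Setting.** Let $m$ be odd, let $s\ge1$, let $a_1,\dots,a_s\ge 0$ be integers, put $a=\sum_{i=1}^s(a_i+1)$ and assume $a<m$. Let the frame be $AR_{m,m-a}$, with horizontal symmetry axis $\ell$; label the squares of $AR_{m,m-a}$ on $\ell$ from left to right by $1,\dots,m-a+1$ and use these labels as a coordinate on $\ell$. Let $c_1,\dots,c_s$ be such that $c_i-a_i/2$ is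 an integer, and let $A_i$ be the set of the $a_i+1$ consecutive integers centred at $c_i$. Assume that the sets $A_i$ are contained in $\{1,\dots,m-a+1\}$ and mutually disjoint. For $T\subseteq\{1,\dots,m-a+1\}$ let $R''(m,m-a;T)$ be the graph obtained from $AR_{m,m-a}$ by deleting the vertices on $\ell$ whose labels are not in $T$, and put $$R''=R''\bigl(m,m-a;\{1,\dots,m-a+1\}\setminus(A_1\cup\cdots\cup A_s)\bigr).$$ All outer regions below have the same centre as the frame, $X^{(c)}$ denotes a copy of $X$ whose centre is the point of coordinate $c$ on $\ell$, and $k$ is a positive integer. **Theorem.** (1) If $k\le\min_i a_i$, then $$\mathrm M\Bigl(AR_{m-k,m-k-a}\setminus\bigcup_{i=1}^s O_{k,a_i-k}^{(c_i)}\Bigr) =2^{\binom{k+1}2(s+1)-k(m+1)}\,\mathrm M\Bigl(AR_{m,m-a}\setminus\bigcup_{i=1}^s O_{0,a_i}^{(c_i)}\Bigr) =2^{\binom{k+1}2(s+1)-k(m+1)}\,\mathrm M(R'').$$ (2) Let $2k<m$, and suppose that every $i$ with $a_i<k$ is such that $A_i$ contains $1$ or $m-a+1$ (the window communicates with the exterior).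 Then $$\mathrm M\Bigl(\Bigl(AR_{m-k,m-k-a}\cup\bigcup_{i:\,a_i<k}AR_{k,k-a_i-1}^{(c_i)}\Bigr)\setminus\bigcup_{i:\,a_i\ge k} O_{k,a_i-k}^{(c_i)}\Bigr) =2^{\binom{k+1}2(s+1)-k(m+1)}\,\mathrm M(R'').$$ (3) Let $2k<m$, and suppose that $1\in A_l$, $m-a+1\in A_r$, $a_l<k$, $a_r<k$, and $k\le a_i$ for all $i\ne l,r$. Then $$\mathrm M\Bigl(C_{m-a-k,\,k}^{\frac{m-1}2-k,\;k-a_r-1,\;\frac{m-1}2-k,\;k-a_l-1}\setminus\bigcup_{i\ne l,r}O_{k,a_i-k}^{(c_i)}\Bigr) =2^{\binom{k+1}2(s+1)-k(m+1)}\,\mathrm M(R'').$$ -/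

import Mathlib

noncomputable section

namespace AztecWindows

/-- A square of an infinite chessboard, given by (column, row). The lattice regions considered here
are made of the squares of one colour: two such squares are neighbours in the (rotated) square
lattice exactly when the chessboard squares share a corner. -/
abbrev Cell : Type := ℤ × ℤ

/-- The graph on the chessboard squares in which two squares are adjacent when they share exactly
a corner, that is, when they are diagonal neighbours. -/
def diagGrid : SimpleGraph Cell where
  Adj p q := |p.1 - q.1| = 1 ∧ |p.2 - q.2| = 1
  symm := ⟨fun p q h => by rwa [abs_sub_comm q.1, abs_sub_comm q.2]⟩
  loopless := ⟨fun p h => by simp at h⟩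

/-- The planar dual graph of a finite region: the induced subgraph of `diagGrid`. -/
abbrev dualGraph (R : Finset Cell) : SimpleGraph {v : Cell // v ∈ R} :=
  diagGrid.comap Subtype.val

/-- The number `M(G)` of perfect matchings of a graph. -/
def numMatchings {V : Type*} (G : SimpleGraph V) : ℕ :=
  Set.ncard {M : G.Subgraph | M.IsPerfectMatching}

/-- A domino: two neighbouring cells. -/
def IsDomino (D : Finset Cell) : Prop :=
  ∃ p q : Cell, diagGrid.Adj p q ∧ D = {p, q}

/-- A domino tiling of the region `R`: a set of pairwise disjoint dominoes with union `R`. -/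
def IsTiling (R : Finset Cell) (P : Finset (Finset Cell)) : Prop :=
  (∀ D ∈ P, IsDomino D) ∧ (P : Set (Finset Cell)).PairwiseDisjoint id ∧ P.biUnion id = R

/-- The number `M(R)` of domino tilings of the region `R`. -/
def numTilings (R : Finset Cell) : ℕ :=
  Set.ncard {P : Finset (Finset Cell) | IsTiling R P}

/-- The `(2 h + 1) × (2 w + 1)` chessboard (height × width) whose central square is `c`. -/
def board (h w : ℕ) (c : Cell) : Finset Cell :=
  Finset.Icc (c.1 - w) (c.1 + w) ×ˢ Finset.Icc (c.2 - h) (c.2 + h)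

/-- A square of `board h w c` is black when it has the colour of the corner square
`(c.1 - w, c.2 - h)` (all four corners have the same colour). -/
def IsBlack (h w : ℕ) (c p : Cell) : Prop :=
  Even ((p.1 - (c.1 - w)) + (p.2 - (c.2 - h)))

instance (h w : ℕ) (c p : Cell) : Decidable (IsBlack h w c p) :=
  inferInstanceAs (Decidable (Even _))

/-- The Aztec rectangle `AR_{h,w}` of height `h` and width `w` centred at `c`: the white squares
of the board with black corners. -/
def aztecRect (h w : ℕ) (c : Cell) : Finset Cell :=
  (board h w c).filter fun p => ¬ IsBlack h w c p

/-- The odd Aztec rectangle `O_{h,w}` centred at `c`: the black squares of the board. -/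
def oddAztecRect (h w : ℕ) (c : Cell) : Finset Cell :=
  (board h w c).filter fun p => IsBlack h w c p

/-- All regions are centred at the square `(0, 0)` and the symmetry axis `ℓ` is the row `0`. The
frame has odd height and width `n`; its cells on `ℓ` are labelled `1, …, n + 1` from left to right,
the leftmost being `(-n, 0)`, and consecutive ones being two columns apart. This is the point of
`ℓ` with coordinate `d / 2` (an integer or a half-integer) in this labelling. -/
def axisPoint (n : ℕ) (d : ℤ) : Cell := (d - 2 - n, 0)

/-- The set of `a + 1` consecutive integers centred at `d / 2` (for `d` of the parity of `a`). -/
def run (a : ℕ) (d : ℤ) : Finset ℤ := Finset.Icc ((d - a) / 2) ((d + a) / 2)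

/-- `R''(m, n; T)`, where `m > n`, `m` is odd and `T ⊆ {1, …, n + 1}`: the vertices of `AR_{m,n}`
on `ℓ` whose labels are not in `T` are deleted. -/
def vertsR'' (m n : ℕ) (T : Finset ℤ) : Finset Cell :=
  aztecRect m n (0, 0) \
    ((Finset.Icc (1 : ℤ) (n + 1)) \ T).image fun t => axisPoint n (2 * t)

/-- The graph `R''(m, n; T)`. -/
abbrev graphR'' (m n : ℕ) (T : Finset ℤ) : SimpleGraph {v : Cell // v ∈ vertsR'' m n T} :=
  dualGraph (vertsR'' m n T)

/-- The union of the windows `O_{k, a_i - k}` centred at the points of coordinate `d_i / 2` on `ℓ`,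
over the indices `i` in `I`. Only used when `k ≤ a_i` for these `i`. -/
def windows {s : ℕ} (n k : ℕ) (a : Fin s → ℕ) (d : Fin s → ℤ) (I : Finset (Fin s)) :
    Finset Cell :=
  I.biUnion fun i => oddAztecRect k (a i - k) (axisPoint n (d i))

/-- The union of the protrusions `AR_{k, k - a_i - 1}` centred at the points of coordinate
`d_i / 2` on `ℓ`, over the indices `i` in `I`. Only used when `a_i < k` for these `i`. -/
def protrusions {s : ℕ} (n k : ℕ) (a : Fin s → ℕ) (d : Fin s → ℤ) (I : Finset (Fin s)) :
    Finset Cell :=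
  I.biUnion fun i => aztecRect k (k - a i - 1) (axisPoint n (d i))

/-- The region `AR''_{m-k,m-k-t} ∖ O_{k,a_1-k} ∪ ⋯ ∪ O_{k,a_s-k}` with frame `AR_{m,m-t}`. -/
def windowedRegion {s : ℕ} (m t k : ℕ) (a : Fin s → ℕ) (d : Fin s → ℤ) : Finset Cell :=
  aztecRect (m - k) (m - k - t) (0, 0) \ windows (m - t) k a d Finset.univ

/-- The region in which every index `i` with `k ≤ a_i` gives a window and every index with
`a_i < k` gives a protrusion. -/
def protrudedRegion {s : ℕ} (m t k : ℕ) (a : Fin s → ℕ) (d : Fin s → ℤ) : Finset Cell :=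
  (aztecRect (m - k) (m - k - t) (0, 0) ∪
      protrusions (m - t) k a d (Finset.univ.filter fun i => a i < k)) \
    windows (m - t) k a d (Finset.univ.filter fun i => k ≤ a i)

/-- The cruciform region `C_{p,q}^{north,east,south,west}` with core centred at `(0, 0)`. The cross
consists of the core, a `(2 q + 1) × (2 p + 1)` board (height × width), and of four arms attached
to its sides, as wide as these and of lengths `2 north + 1`, `2 east + 1`, `2 south + 1` and
`2 west + 1`; the cells are the squares of the cross that have the colour of the corners
of the core. -/
def cruciform (p q north east south west : ℕ) : Finset Cell :=
  ((Finset.Icc (-(p : ℤ)) p ×ˢ Finset.Icc (-(q + (2 * south + 1) : ℤ)) (q + (2 * north + 1))) ∪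
    (Finset.Icc (-(p + (2 * west + 1) : ℤ)) (p + (2 * east + 1)) ×ˢ
      Finset.Icc (-(q : ℤ)) q)).filter fun x => IsBlack q p (0, 0) x

end AztecWindows

end

open AztecWindows

/-! The proof is by complementation. Colour the 4-cycles of the rotated square lattice like a
chessboard and keep one colour class: these cells are edge-disjoint, and each vertex is a corner of
at most two of them that are kept in a finite set `C`. If all edges of a region lie in cells of `C`,
a tiling amounts to choosing, in each cell, a set `S` of corners that are matched inside that cell,
so that every vertex of the region is chosen exactly once. Replacing each `S` by its complement in
the cell gives such a choice for the complementary region, in which a vertex of two cells stays and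
a vertex of one cell switches sides. In one cell, `S` and `Sᶜ` have equally many matchings, except
that the empty set has 1 and the full set has 2. The weight `q ^ #S` with `q ^ 4 = 2` absorbs this
discrepancy, so `M(R) / q ^ #R` is the same for both regions (`numTilings_complement`).

Starting from the frame with runs of vertices removed on the axis (height 0), each complementation
shrinks the outer boundary by one and makes every window one unit narrower and taller. A window of
half-width 0 next turns into a protrusion, which then grows. `Placement.region_add_region` verifies
that the regions at heights `k` and `k + 1` are complementary, and `Placement.edge_inCells` that the
cells between them contain all their edges. Iterating, the exponent of 2 is a quarter of the
difference of the numbers of vertices at heights `K` and 0 (`Placement.card_protrudedRegion`). All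
three statements are instances, the cruciform region being the case of protrusions at both ends. -/

namespace AztecWindows
open Finset

/-! ### Tilings as choices of sides in edge-disjoint cells -/

/-- The corners of the cell with centre `c`, in clockwise order from the top. -/
def corner (c : Cell) : Fin 4 → Cell :=
  ![(c.1, c.2 + 1), (c.1 + 1, c.2), (c.1, c.2 - 1), (c.1 - 1, c.2)]

/-- The `j`-th side of the cell with centre `c`. -/
def side (c : Cell) (j : Fin 4) : Finset Cell := {corner c j, corner c (j + 1)}

/-- The number of sides in `E` that contain the `j`-th corner of a cell. -/
def coverCount (E : Finset (Fin 4)) (j : Fin 4) : ℕ :=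
  (if j ∈ E then 1 else 0) + if j - 1 ∈ E then 1 else 0

/-- The total weight of the vertex `v` over the cells with centres in `C`. -/
def load (C : Finset Cell) (u : C → Fin 4 → ℕ) (v : Cell) : ℕ :=
  ∑ c : C, ∑ j, if corner c j = v then u c j else 0

lemma corner_injective (c : Cell) : Function.Injective (corner c) := by
  intro i j h
  fin_cases i <;> fin_cases j <;> simp [corner] at h ⊢ <;> omega

lemma isDomino_side (c : Cell) (j : Fin 4) : IsDomino (side c j) := by
  refine ⟨_, _, ?_, rfl⟩
  fin_cases j <;> simp [corner, diagGrid]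

/-- The centres in `C` lie in one class modulo the doubled lattice. -/
def SameParity (C : Finset Cell) : Prop :=
  ∀ c ∈ C, ∀ c' ∈ C, Even (c.1 - c'.1) ∧ Even (c.2 - c'.2)

lemma pair_eq_pair {α : Type*} [DecidableEq α] {a b c d : α}
    (h : ({a, b} : Finset α) = {c, d}) : a = c ∧ b = d ∨ a = d ∧ b = c := by
  have := congrArg (fun s : Finset α => (s : Set α)) h
  simp only [coe_insert, coe_singleton] at this
  exact Set.pair_eq_pair_iff.mp this

lemma side_inj {c c' : Cell} (h1 : Even (c.1 - c'.1)) (h2 : Even (c.2 - c'.2)) {j j' : Fin 4}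
    (h : side c j = side c' j') : c = c' ∧ j = j' := by
  obtain ⟨x, y⟩ := c
  obtain ⟨x', y'⟩ := c'
  rw [Int.even_iff] at h1 h2
  have := pair_eq_pair h
  fin_cases j <;> fin_cases j' <;> simp [corner] at this h1 h2 ⊢ <;> omega

/-- Disjointness and covering together become one count per vertex, a form that can be summed over
cells. -/
lemma isTiling_iff {R : Finset Cell} {P : Finset (Finset Cell)} :
    IsTiling R P ↔ (∀ D ∈ P, IsDomino D) ∧
      ∀ v, (∑ D ∈ P, if v ∈ D then 1 else 0) = if v ∈ R then 1 else 0 := by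
  refine and_congr_right fun _ => ⟨?_, ?_⟩
  · rintro ⟨hd, rfl⟩ v
    by_cases hv : v ∈ P.biUnion id
    · obtain ⟨D, hD, hvD⟩ := mem_biUnion.mp hv
      rw [if_pos hv, sum_eq_single_of_mem D hD, if_pos (show v ∈ D from hvD)]
      intro D' hD' hne
      exact if_neg fun hv' => Finset.disjoint_left.mp (hd hD' hD hne) hv' hvD
    · rw [if_neg hv]
      refine sum_eq_zero fun D hD => if_neg fun h => hv (mem_biUnion.mpr ⟨D, hD, h⟩)
  · intro h
    constructor
    · intro D hD D' hD' hne
      refine Finset.disjoint_left.mpr fun v hv hv' => ?_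
      have h2 : (∑ D ∈ ({D, D'} : Finset (Finset Cell)), if v ∈ D then 1 else 0) ≤
          ∑ D ∈ P, if v ∈ D then 1 else 0 :=
        sum_le_sum_of_subset (by
          intro X hX
          simp only [mem_insert, mem_singleton] at hX
          rcases hX with rfl | rfl
          exacts [hD, hD'])
      have hv1 : v ∈ D := hv
      have hv2 : v ∈ D' := hv'
      rw [sum_pair hne, if_pos hv1, if_pos hv2, h v] at h2
      split_ifs at h2 <;> omega
    · ext v
      have hv := h v
      constructor
      · intro hm
        obtain ⟨D, hD, hvD⟩ := mem_biUnion.mp hm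
        by_contra hR
        rw [if_neg hR, sum_eq_zero_iff] at hv
        exact absurd (hv D hD) (by simp [show v ∈ D from hvD])
      · intro hR
        by_contra hm
        rw [if_pos hR, sum_eq_zero] at hv
        · omega
        · exact fun D hD => if_neg fun h => hm (mem_biUnion.mpr ⟨D, hD, h⟩)

/-- The set of sides chosen in the cells with centres in `C`. -/
def sideSet (C : Finset Cell) (E : C → Finset (Fin 4)) : Finset (Finset Cell) :=
  univ.biUnion fun c => (E c).image (side c)

lemma mem_sideSet {C : Finset Cell} (hC : SameParity C) {E : C → Finset (Fin 4)} {c : C}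
    {j : Fin 4} : side c j ∈ sideSet C E ↔ j ∈ E c := by
  simp only [sideSet, mem_biUnion, mem_univ, true_and, mem_image]
  constructor
  · rintro ⟨c', j', hj, h⟩
    obtain ⟨h1, h2⟩ := hC c' c'.2 c c.2
    obtain ⟨h3, rfl⟩ := side_inj h1 h2 h
    rwa [← Subtype.ext h3]
  · exact fun h => ⟨c, j, h, rfl⟩

/-- Corner `j` lies on exactly the sides `j` and `j - 1` of its cell, and different cells share no
side. -/
lemma sum_sideSet {C : Finset Cell} (hC : SameParity C) (E : C → Finset (Fin 4)) (v : Cell) :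
    (∑ D ∈ sideSet C E, if v ∈ D then 1 else 0) = load C (fun c => coverCount (E c)) v := by
  have hinj : ∀ c c' : C, ∀ j j', side c j = side c' j' → c = c' ∧ j = j' := by
    intro c c' j j' h
    obtain ⟨h1, h2⟩ := hC c c.2 c' c'.2
    obtain ⟨h3, h4⟩ := side_inj h1 h2 h
    exact ⟨Subtype.ext h3, h4⟩
  rw [sideSet, sum_biUnion, load]
  · refine sum_congr rfl fun c _ => ?_
    rw [sum_image fun j _ j' _ h => (hinj c c j j' h).2]
    have key : ∀ j, (if v ∈ side c j then 1 else 0) =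
        (if corner c j = v then 1 else 0) + if corner c (j + 1) = v then 1 else 0 := by
      intro j
      have : corner c j ≠ corner c (j + 1) := fun h => by
        exact absurd (corner_injective _ h) ((by decide : ∀ j : Fin 4, j ≠ j + 1) j)
      simp only [side, mem_insert, mem_singleton]
      by_cases h1 : corner c j = v <;> by_cases h2 : corner c (j + 1) = v
      · exact absurd (h1.trans h2.symm) this
      · simp [h1, h2, Ne.symm h2]
      · simp [h1, h2, Ne.symm h1]
      · simp [h1, h2, Ne.symm h1, Ne.symm h2]
    have h1 : ∀ f : Fin 4 → ℕ, ∑ j ∈ E c, f j = ∑ j, if j ∈ E c then f j else 0 := by simp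
    rw [h1]
    simp only [key, coverCount, Fin.sum_univ_four, Fin.isValue, show (0 : Fin 4) - 1 = 3 from rfl,
      show (1 : Fin 4) - 1 = 0 from rfl, show (2 : Fin 4) - 1 = 1 from rfl,
      show (3 : Fin 4) - 1 = 2 from rfl, show (0 : Fin 4) + 1 = 1 from rfl,
      show (1 : Fin 4) + 1 = 2 from rfl, show (2 : Fin 4) + 1 = 3 from rfl,
      show (3 : Fin 4) + 1 = 0 from rfl]
    have h3 : ∀ (p q : Prop) [Decidable p] [Decidable q], (if p then (if q then 1 else 0) else 0)
        = if q then (if p then 1 else 0) else 0 := by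
      intro p q _ _
      split_ifs <;> rfl
    have h4 : ∀ (q : Prop) [Decidable q] (x y : ℕ), (if q then x + y else 0) =
        (if q then x else 0) + if q then y else 0 := by
      intro q _ x y
      split_ifs <;> rfl
    simp only [h4, h3 (_ ∈ E c)]
    ring
  · intro c _ c' _ hne
    refine Finset.disjoint_left.mpr fun D hD hD' => ?_
    obtain ⟨j, _, rfl⟩ := mem_image.mp hD
    obtain ⟨j', _, h⟩ := mem_image.mp hD'
    exact hne (hinj _ _ _ _ h).1.symm

lemma sideSet_injective {C : Finset Cell} (hC : SameParity C) :
    Function.Injective (sideSet C) := by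
  intro E E' h
  ext c j
  rw [← mem_sideSet hC, h, mem_sideSet hC]

/-- An edge of the lattice is a side of exactly two 4-cycles, centred at the two other corners of
the unit square with diagonal `p`, `q`. -/
lemma exists_side {p q : Cell} (h : diagGrid.Adj p q) {C : Finset Cell}
    (hc : (p.1, q.2) ∈ C ∨ (q.1, p.2) ∈ C) : ∃ c : C, ∃ j, side c j = {p, q} := by
  have key : ∀ p q : Cell, diagGrid.Adj p q → ∃ j, side (p.1, q.2) j = {p, q} := by
    rintro ⟨x, y⟩ ⟨x', y'⟩ h
    simp only [diagGrid] at h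
    obtain ⟨h1, h2⟩ := h
    rcases (abs_eq zero_le_one).mp h1 with h1 | h1 <;>
      rcases (abs_eq zero_le_one).mp h2 with h2 | h2
    · obtain rfl : x = x' + 1 := by omega
      obtain rfl : y = y' + 1 := by omega
      refine ⟨3, ?_⟩
      simp [side, corner, pair_comm]
    · obtain rfl : x = x' + 1 := by omega
      obtain rfl : y' = y + 1 := by omega
      refine ⟨2, ?_⟩
      simp [side, corner]
    · obtain rfl : x' = x + 1 := by omega
      obtain rfl : y = y' + 1 := by omega
      refine ⟨0, ?_⟩
      simp [side, corner]
    · obtain rfl : x' = x + 1 := by omega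
      obtain rfl : y' = y + 1 := by omega
      refine ⟨1, ?_⟩
      simp [side, corner, pair_comm]
  rcases hc with hc | hc
  · obtain ⟨j, hj⟩ := key p q h
    exact ⟨⟨_, hc⟩, j, hj⟩
  · obtain ⟨j, hj⟩ := key q p h.symm
    exact ⟨⟨_, hc⟩, j, hj.trans (pair_comm _ _)⟩

open Classical in
lemma numTilings_eq {C R : Finset Cell} (hC : SameParity C)
    (hR : ∀ p ∈ R, ∀ q ∈ R, diagGrid.Adj p q → (p.1, q.2) ∈ C ∨ (q.1, p.2) ∈ C) :
    numTilings R = #{E : C → Finset (Fin 4) |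
      ∀ v, load C (fun c => coverCount (E c)) v = if v ∈ R then 1 else 0} := by
  rw [← card_image_of_injective _ (sideSet_injective hC), ← Set.ncard_coe_finset, numTilings]
  congr 1
  ext P
  simp only [Set.mem_ofPred_eq, coe_image, coe_filter, mem_univ, true_and, Set.mem_image]
  constructor
  · intro hP
    have hE : sideSet C (fun c => {j | side c j ∈ P}) = P := by
      ext D
      simp only [sideSet, mem_biUnion, mem_univ, true_and, mem_image, mem_filter]
      constructor
      · rintro ⟨c, j, hj, rfl⟩
        exact hj
      · intro hD
        obtain ⟨p, q, hpq, rfl⟩ := hP.1 D hD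
        have hsub : ∀ v ∈ ({p, q} : Finset Cell), v ∈ R := fun v hv => by
          rw [← hP.2.2]
          exact mem_biUnion.mpr ⟨_, hD, hv⟩
        obtain ⟨c, j, hj⟩ := exists_side hpq
          (hR p (hsub p (by simp)) q (hsub q (by simp)) hpq)
        exact ⟨c, j, hj ▸ hD, hj⟩
    refine ⟨_, fun v => ?_, hE⟩
    rw [← sum_sideSet hC, hE]
    exact (isTiling_iff.mp hP).2 v
  · rintro ⟨E, hE, rfl⟩
    refine isTiling_iff.mpr ⟨fun D hD => ?_, fun v => (sum_sideSet hC E v).trans (hE v)⟩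
    simp only [sideSet, mem_biUnion, mem_univ, true_and, mem_image] at hD
    obtain ⟨c, j, -, rfl⟩ := hD
    exact isDomino_side _ _

/-! ### Complementation -/

/-- The number of perfect matchings of the subgraph of a cell induced by the corners in `S`. -/
def cellMatchings (S : Finset (Fin 4)) : ℕ :=
  #{E : Finset (Fin 4) | ∀ j, coverCount E j = if j ∈ S then 1 else 0}

/-- The set of corners in `S c`, over the cells `c`, has exactly one copy of each vertex in `R`. -/
def Covers (C : Finset Cell) (S : C → Finset (Fin 4)) (R : Finset Cell) : Prop :=
  ∀ v, load C (fun c j => if j ∈ S c then 1 else 0) v = if v ∈ R then 1 else 0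

lemma le_load (C : Finset Cell) (u : C → Fin 4 → ℕ) (c : C) (j : Fin 4) :
    u c j ≤ load C u (corner c j) := by
  rw [load]
  refine le_trans ?_ (single_le_sum (fun _ _ => Nat.zero_le _) (mem_univ c))
  refine le_trans ?_ (single_le_sum (fun _ _ => Nat.zero_le _) (mem_univ j))
  simp

-- The tilings are grouped by the set of corners that they cover in each cell. Once these sets are
-- fixed, the cells are independent, whence the product.
open Classical in
lemma numTilings_eq_sum {C R : Finset Cell} (hC : SameParity C)
    (hR : ∀ p ∈ R, ∀ q ∈ R, diagGrid.Adj p q → (p.1, q.2) ∈ C ∨ (q.1, p.2) ∈ C) :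
    numTilings R = ∑ S : C → Finset (Fin 4) with Covers C S R, ∏ c, cellMatchings (S c) := by
  -- No corner is covered twice, as the load of its vertex is at most 1; the cover count is
  -- therefore the indicator of a set.
  have hcov : ∀ E : C → Finset (Fin 4),
      (∀ v, load C (fun c => coverCount (E c)) v = if v ∈ R then 1 else 0) →
      (fun c => coverCount (E c)) = fun c j => if j ∈ ({j | coverCount (E c) j = 1} :
        Finset (Fin 4)) then 1 else 0 := by
    intro E hE
    ext c j
    have h := le_load C (fun c => coverCount (E c)) c j
    rw [hE] at h
    simp only [mem_filter, mem_univ, true_and]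
    split_ifs at h ⊢ <;> omega
  rw [numTilings_eq hC hR, card_eq_sum_card_fiberwise
    (f := fun E c => ({j | coverCount (E c) j = 1} : Finset (Fin 4)))
    (t := {S : C → Finset (Fin 4) | Covers C S R})]
  · refine sum_congr rfl fun S hS => ?_
    simp only [mem_filter, mem_univ, true_and] at hS
    simp only [cellMatchings]
    rw [← Fintype.card_piFinset]
    congr 1
    ext E
    simp only [mem_filter, mem_univ, true_and, Fintype.mem_piFinset]
    constructor
    · rintro ⟨hE, rfl⟩ c j
      exact congrFun (congrFun (hcov E hE) c) j
    · intro h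
      refine ⟨fun v => ?_, ?_⟩
      · rw [← hS v]
        congr 1
        ext c j
        exact h c j
      · ext c j
        simp [h]
  · intro E hE
    simp only [coe_filter, mem_univ, true_and, Set.mem_ofPred_eq] at hE ⊢
    intro v
    rw [← hE v]
    congr 1
    exact (hcov E hE).symm

lemma sum_card_of_covers {C R : Finset Cell} {S : C → Finset (Fin 4)} (h : Covers C S R) :
    ∑ c, #(S c) = #R := by
  have h1 : ∀ c : C, #(S c) =
      ∑ v ∈ R ∪ univ.biUnion (fun c : C => univ.image (corner c)), ∑ j,
        if corner c j = v then (if j ∈ S c then 1 else 0) else 0 := by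
    intro c
    rw [sum_comm]
    have : #(S c) = ∑ j, if j ∈ S c then 1 else 0 := by simp
    rw [this]
    refine sum_congr rfl fun j _ => ?_
    have hj : corner c j ∈ R ∪ univ.biUnion (fun c : C => univ.image (corner c)) :=
      mem_union_right _ (mem_biUnion.mpr ⟨c, mem_univ _, mem_image_of_mem _ (mem_univ _)⟩)
    rw [sum_ite_eq, if_pos hj]
  rw [sum_congr rfl fun c _ => h1 c, sum_comm]
  have h2 := fun v => h v
  simp only [load] at h2
  rw [sum_congr rfl fun v _ => h2 v]
  simp

/-- Odd sets and pairs of opposite corners have no matching, and neither do their complements; pairs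
of adjacent corners have one each. Only the empty and the full set, with 1 and 2 matchings, need the
factor `q ^ 4 = 2`. -/
lemma cellMatchings_compl (S : Finset (Fin 4)) {q : ℝ} (hq : q ^ 4 = 2) :
    cellMatchings Sᶜ * q ^ #S = cellMatchings S * q ^ #Sᶜ := by
  have h : ∀ S : Finset (Fin 4), (cellMatchings S = 0 ∧ cellMatchings Sᶜ = 0) ∨
      (cellMatchings S = cellMatchings Sᶜ ∧ #S = #Sᶜ) ∨
      (#S = 0 ∧ #Sᶜ = 4 ∧ cellMatchings S = 1 ∧ cellMatchings Sᶜ = 2) ∨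
      (#S = 4 ∧ #Sᶜ = 0 ∧ cellMatchings S = 2 ∧ cellMatchings Sᶜ = 1) := by
    decide +kernel
  rcases h S with ⟨h1, h2⟩ | ⟨h1, h2⟩ | ⟨h1, h2, h3, h4⟩ | ⟨h1, h2, h3, h4⟩
  · simp [h1, h2]
  · rw [h1, h2]
  · simp [h1, h2, h3, h4, hq]
  · simp [h1, h2, h3, h4, hq]

lemma Covers.compl {C R R' : Finset Cell} {S : C → Finset (Fin 4)}
    (hv : ∀ v, (if v ∈ R then 1 else 0) + (if v ∈ R' then 1 else 0) = load C (fun _ _ => 1) v)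
    (hS : Covers C S R) : Covers C (fun c => (S c)ᶜ) R' := by
  intro v
  have h1 : load C (fun c j => if j ∈ S c then 1 else 0) v +
      load C (fun c j => if j ∈ (S c)ᶜ then 1 else 0) v = load C (fun _ _ => 1) v := by
    simp only [load, ← sum_add_distrib, mem_compl]
    refine sum_congr rfl fun c _ => sum_congr rfl fun j _ => ?_
    split_ifs <;> rfl
  rw [← hv v, hS v] at h1
  exact Nat.add_left_cancel h1

/-- Complementation: if each edge of `R` and of `R'` lies in one of the edge-disjoint cells centred
at `C`, and each vertex lies in as many of these cells as it does in the regions `R` and `R'`, then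
the numbers of tilings of `R` and `R'` differ by an explicit power of two. -/
theorem numTilings_complement {C R R' : Finset Cell} (hC : SameParity C)
    (hR : ∀ p ∈ R, ∀ q ∈ R, diagGrid.Adj p q → (p.1, q.2) ∈ C ∨ (q.1, p.2) ∈ C)
    (hR' : ∀ p ∈ R', ∀ q ∈ R', diagGrid.Adj p q → (p.1, q.2) ∈ C ∨ (q.1, p.2) ∈ C)
    (hv : ∀ v, (if v ∈ R then 1 else 0) + (if v ∈ R' then 1 else 0) = load C (fun _ _ => 1) v)
    {q : ℝ} (hq : q ^ 4 = 2) :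
    numTilings R' * q ^ #R = numTilings R * q ^ #R' := by
  classical
  rw [numTilings_eq_sum hC hR, numTilings_eq_sum hC hR']
  push_cast
  rw [sum_mul, sum_mul]
  symm
  refine sum_bij' (fun S _ c => (S c)ᶜ) (fun S _ c => (S c)ᶜ) ?_ ?_ ?_ ?_ ?_
  · intro S hS
    simpa using Covers.compl hv (by simpa using hS)
  · intro S hS
    simpa using Covers.compl (fun v => (add_comm _ _).trans (hv v)) (by simpa using hS)
  · simp
  · simp
  · intro S hS
    have hS : Covers C S R := by simpa using hS
    rw [← sum_card_of_covers hS, ← sum_card_of_covers (hS.compl hv), ← prod_pow_eq_pow_sum,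
      ← prod_pow_eq_pow_sum, ← prod_mul_distrib, ← prod_mul_distrib]
    exact prod_congr rfl fun c _ => (cellMatchings_compl (S c) hq).symm

/-! ### Indicator functions of rectangles, windows and protrusions -/

/-- The windows centred at abscissa `e i` with half-width `a i` are disjoint and on the axis
`[-n, n]`, and those with `a i < K` touch an end of it. -/
structure Placement {s : ℕ} (n K : ℤ) (a e : Fin s → ℤ) : Prop where
  nonneg : ∀ i, 0 ≤ a i
  parity : ∀ i, (e i - a i - n) % 2 = 0
  left_le : ∀ i, -n ≤ e i - a i
  le_right : ∀ i, e i + a i ≤ n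
  sep : ∀ i j, i ≠ j → e i + a i + 2 ≤ e j - a j ∨ e j + a j + 2 ≤ e i - a i
  touch : ∀ i, a i < K → e i - a i = -n ∨ e i + a i = n
  le_width : K ≤ n

/-- The indicator function of a rectangle centred at the origin. -/
def box (w h : ℤ) (p : Cell) : ℤ := if |p.1| ≤ w ∧ |p.2| ≤ h then 1 else 0

lemma box_of_neg {w : ℤ} (hw : w < 0) (h : ℤ) (p : Cell) : box w h p = 0 := by
  rw [box, if_neg]
  rintro ⟨h1, -⟩
  exact absurd ((abs_nonneg _).trans h1) (by omega)

lemma box_shrink_horizontal {w h x y : ℤ} (hw : 1 ≤ w) (hx : (x - w) % 2 = 0)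
    (hy : (y - h) % 2 = 1) : box w h (x, y) + box (w - 1) (h - 1) (x, y) =
      box (w - 1) (h - 1) (x - 1, y) + box (w - 1) (h - 1) (x + 1, y) := by
  simp only [box, abs_le]
  split_ifs <;> omega

lemma box_shrink_vertical {w h x y : ℤ} (hh : 1 ≤ h) (hx : (x - w) % 2 = 1)
    (hy : (y - h) % 2 = 0) : box w h (x, y) + box (w - 1) (h - 1) (x, y) =
      box (w - 1) (h - 1) (x, y - 1) + box (w - 1) (h - 1) (x, y + 1) := by
  simp only [box, abs_le]
  split_ifs <;> omega

/-- The same count for a window, which becomes narrower but taller: here the parity of `y` makes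
heights `h` and `h + 1` equivalent. -/
lemma box_trade_horizontal {w h x y : ℤ} (hw : 1 ≤ w) (hx : (x - w) % 2 = 0)
    (hy : (y - h) % 2 = 0) : box w h (x, y) + box (w - 1) (h + 1) (x, y) =
      box (w - 1) h (x - 1, y) + box (w - 1) h (x + 1, y) := by
  simp only [box, abs_le]
  split_ifs <;> omega

lemma box_trade_vertical {w h x y : ℤ} (hh : 0 ≤ h) (hx : (x - w) % 2 = 1)
    (hy : (y - h) % 2 = 1) : box w h (x, y) + box (w - 1) (h + 1) (x, y) =
      box (w - 1) h (x, y - 1) + box (w - 1) h (x, y + 1) := by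
  simp only [box, abs_le]
  split_ifs <;> omega

/-- The contribution of a window or protrusion to the indicator function of a region. -/
def vertexTerm (k a : ℤ) (p : Cell) : ℤ := box (k - a - 1) k p - box (a - k) k p

/-- The contribution of a window or protrusion to the indicator function of the set of cells. -/
def cellTerm (k a : ℤ) (p : Cell) : ℤ := box (k - a - 1) k p - box (a - k - 1) k p

/-- Boxes of negative half-width vanish, so one signed formula describes a window for `k ≤ a` and a
protrusion for `k > a`. The former trades width for height; the latter, read from `k + 1` down to
`k`, shrinks. -/
lemma vertexTerm_add_horizontal {k a x y : ℤ} (hx : (x - a - k) % 2 = 0)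
    (hy : (y - k) % 2 = 0) : vertexTerm k a (x, y) + vertexTerm (k + 1) a (x, y) =
      cellTerm k a (x - 1, y) + cellTerm k a (x + 1, y) := by
  unfold vertexTerm cellTerm
  rcases lt_trichotomy k a with h | rfl | h
  · have := @box_trade_horizontal (a - k) k x y (by omega) (by omega) (by omega)
    rw [← sub_sub a k 1, box_of_neg (w := k - a - 1) (by omega),
      box_of_neg (w := k - a - 1) (by omega), box_of_neg (w := k - a - 1) (by omega),
      box_of_neg (w := k + 1 - a - 1) (by omega)]
    omega
  -- At `k = a` the window and the next protrusion both have half-width 0, and no cell is involved.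
  -- Their heights `k` and `k + 1` agree on the rows considered, so they cancel.
  · rw [box_of_neg (w := k - k - 1) (by omega), box_of_neg (w := k - k - 1) (by omega),
      box_of_neg (w := k - k - 1) (by omega), box_of_neg (w := k - (k + 1)) (by omega)]
    simp only [box, abs_le]
    split_ifs <;> omega
  · have := @box_shrink_horizontal (k - a) (k + 1) x y (by omega) (by omega) (by omega)
    rw [add_sub_cancel_right] at this
    rw [box_of_neg (w := a - k - 1) (by omega), box_of_neg (w := a - k - 1) (by omega),
      box_of_neg (w := a - k) (by omega), box_of_neg (w := a - (k + 1)) (by omega),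
      show k + 1 - a - 1 = k - a by ring]
    omega

lemma vertexTerm_add_vertical {k a x y : ℤ} (hk : 0 ≤ k) (hx : (x - a - k) % 2 = 1)
    (hy : (y - k) % 2 = 1) : vertexTerm k a (x, y) + vertexTerm (k + 1) a (x, y) =
      cellTerm k a (x, y - 1) + cellTerm k a (x, y + 1) := by
  unfold vertexTerm cellTerm
  rcases lt_trichotomy k a with h | rfl | h
  · have := @box_trade_vertical (a - k) k x y (by omega) (by omega) (by omega)
    rw [← sub_sub a k 1, box_of_neg (w := k - a - 1) (by omega),
      box_of_neg (w := k - a - 1) (by omega), box_of_neg (w := k - a - 1) (by omega),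
      box_of_neg (w := k + 1 - a - 1) (by omega)]
    omega
  · rw [box_of_neg (w := k - k - 1) (by omega), box_of_neg (w := k - k - 1) (by omega),
      box_of_neg (w := k - k - 1) (by omega), box_of_neg (w := k - (k + 1)) (by omega)]
    simp only [box, abs_le]
    split_ifs <;> omega
  · have := @box_shrink_vertical (k - a) (k + 1) x y (by omega) (by omega) (by omega)
    rw [add_sub_cancel_right] at this
    rw [box_of_neg (w := a - k - 1) (by omega), box_of_neg (w := a - k - 1) (by omega),
      box_of_neg (w := a - k) (by omega), box_of_neg (w := a - (k + 1)) (by omega),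
      show k + 1 - a - 1 = k - a by ring]
    omega

/-- A rectangle with protrusions of half-widths `p i` and windows of half-widths `q i`. -/
def InShape {s : ℕ} (w h k : ℤ) (p q e : Fin s → ℤ) (v : Cell) : Prop :=
  ((|v.1| ≤ w ∧ |v.2| ≤ h) ∨ ∃ i, |v.1 - e i| ≤ p i ∧ |v.2| ≤ k) ∧
    ¬ ∃ i, |v.1 - e i| ≤ q i ∧ |v.2| ≤ k

lemma ite_exists {ι : Type*} [Fintype ι] (p : ι → Prop) [DecidablePred p] [Decidable (∃ i, p i)]
    (h : ∀ i j, p i → p j → i = j) :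
    (if ∃ i, p i then 1 else 0 : ℤ) = ∑ i, if p i then 1 else 0 := by
  split_ifs with hp
  · obtain ⟨i, hi⟩ := hp
    rw [sum_eq_single i, if_pos hi]
    · exact fun j _ hj => if_neg fun h' => hj (h j i h' hi)
    · simp
  · rw [sum_eq_zero]
    exact fun i _ => if_neg fun h' => hp ⟨i, h'⟩

section
variable {s : ℕ} {n K : ℤ} {a e : Fin s → ℤ} (H : Placement n K a e)
include H

/-- A protrusion arises only from a window touching an end of the axis, and it begins just where the
shrunken frame stops. -/
lemma Placement.protrusion_outside {k x : ℤ} (hk : k ≤ K) {i : Fin s}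
    (h : |x - e i| ≤ k - a i - 1) :
    (e i - a i = -n ∧ x < -(n - k)) ∨ (e i + a i = n ∧ n - k < x) := by
  rw [abs_le] at h
  have := H.touch i (by omega)
  have := H.nonneg i
  omega

lemma Placement.protrusion_unique {k x : ℤ} (hk : k ≤ K) {i j : Fin s}
    (hi : |x - e i| ≤ k - a i - 1) (hj : |x - e j| ≤ k - a j - 1) : i = j := by
  by_contra hne
  have := H.protrusion_outside hk hi
  have := H.protrusion_outside hk hj
  have := H.sep i j hne
  have := H.le_width
  have := H.nonneg i
  have := H.nonneg j
  omega

lemma Placement.window_unique {r x : ℤ} (hr : 0 ≤ r) {i j : Fin s}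
    (hi : |x - e i| ≤ a i - r) (hj : |x - e j| ≤ a j - r) : i = j := by
  by_contra hne
  rw [abs_le] at hi hj
  have := H.sep i j hne
  omega

lemma Placement.window_inside {r x : ℤ} {i : Fin s} (h : |x - e i| ≤ a i - r) :
    |x| ≤ n - r := by
  rw [abs_le] at h ⊢
  have := H.left_le i
  have := H.le_right i
  omega

-- Protrusions are disjoint from the frame and from each other; windows are disjoint and inside the
-- frame. Hence the indicator is additive. The parameter `r` is `k` for regions and `k + 1` for sets
-- of centres.
open Classical in
lemma Placement.ite_inShape {k r h : ℤ} (hk : k ≤ K) (hk0 : 0 ≤ k) (hr : k ≤ r) (hh : k ≤ h)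
    (v : Cell) :
    (if InShape (n - r) h k (fun i => k - a i - 1) (fun i => a i - r) e v then 1 else 0 : ℤ) =
      box (n - r) h v +
        ∑ i, (box (k - a i - 1) k (v.1 - e i, v.2) - box (a i - r) k (v.1 - e i, v.2)) := by
  have h1 : (if ∃ i, |v.1 - e i| ≤ k - a i - 1 ∧ |v.2| ≤ k then 1 else 0 : ℤ) =
      ∑ i, box (k - a i - 1) k (v.1 - e i, v.2) := by
    rw [ite_exists _ fun i j hi hj => H.protrusion_unique hk hi.1 hj.1]
    exact sum_congr rfl fun i _ => by simp only [box]
  have h2 : (if ∃ i, |v.1 - e i| ≤ a i - r ∧ |v.2| ≤ k then 1 else 0 : ℤ) =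
      ∑ i, box (a i - r) k (v.1 - e i, v.2) := by
    rw [ite_exists _ fun i j hi hj => H.window_unique (by omega) hi.1 hj.1]
    exact sum_congr rfl fun i _ => by simp only [box]
  have h3 : (∃ i, |v.1 - e i| ≤ k - a i - 1 ∧ |v.2| ≤ k) → ¬ (|v.1| ≤ n - r ∧ |v.2| ≤ h) := by
    rintro ⟨i, hi, -⟩ ⟨hx, -⟩
    have := H.protrusion_outside hk hi
    rw [abs_le] at hx
    omega
  have h4 : (∃ i, |v.1 - e i| ≤ a i - r ∧ |v.2| ≤ k) → |v.1| ≤ n - r ∧ |v.2| ≤ h := by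
    rintro ⟨i, hi, hy⟩
    exact ⟨H.window_inside hi, hy.trans hh⟩
  rw [sum_sub_distrib, ← h1, ← h2]
  simp only [InShape, box]
  by_cases hF : |v.1| ≤ n - r ∧ |v.2| ≤ h
  · have hV := mt h3 (not_not.mpr hF)
    by_cases hW : ∃ i, |v.1 - e i| ≤ a i - r ∧ |v.2| ≤ k <;> simp only [hF, hV, hW] <;> simp
  · have hW := mt h4 hF
    by_cases hV : ∃ i, |v.1 - e i| ≤ k - a i - 1 ∧ |v.2| ≤ k <;> simp only [hF, hV, hW] <;> simp

/-! ### Consecutive regions and the cells between them -/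

/-- Membership in the region at height `k`. -/
abbrev InRegion {s : ℕ} (n m k : ℤ) (a e : Fin s → ℤ) (v : Cell) : Prop :=
  (v.1 + v.2 - n) % 2 = 0 ∧
    InShape (n - k) (m - k) k (fun i => k - a i - 1) (fun i => a i - k) e v

/-- Membership in the set of centres of the cells between the regions at heights `k`, `k + 1`. -/
abbrev InCells {s : ℕ} (n m k : ℤ) (a e : Fin s → ℤ) (c : Cell) : Prop :=
  ((c.1 - n - k) % 2 = 1 ∧ (c.2 - k) % 2 = 0) ∧
    InShape (n - (k + 1)) (m - (k + 1)) k (fun i => k - a i - 1) (fun i => a i - (k + 1)) e c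

-- Additivity of the indicators reduces the claim to the frame and to each hole separately. Vertices
-- with `y ≡ k` modulo 2 have their centres to the left and right, the others above and below; the
-- oddness of `m` supplies the parity needed at the frame.
open Classical in
lemma Placement.region_add_region {m k : ℤ} (hk : k + 1 ≤ K) (hk0 : 0 ≤ k) (hm : 2 * K < m)
    (hm1 : m % 2 = 1) (x y : ℤ) :
    (if InRegion n m k a e (x, y) then 1 else 0 : ℤ) +
      (if InRegion n m (k + 1) a e (x, y) then 1 else 0) =
      (if InCells n m k a e (x, y - 1) then 1 else 0) +
      (if InCells n m k a e (x, y + 1) then 1 else 0) +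
      (if InCells n m k a e (x - 1, y) then 1 else 0) +
      (if InCells n m k a e (x + 1, y) then 1 else 0) := by
  have hK := H.le_width
  by_cases hpar : (x + y - n) % 2 = 0
  · have e1 := H.ite_inShape (k := k) (r := k) (h := m - k) (by omega) hk0 le_rfl (by omega) (x, y)
    have e2 := H.ite_inShape (k := k + 1) (r := k + 1) (h := m - (k + 1)) (by omega) (by omega)
      le_rfl (by omega) (x, y)
    have e3 := fun v => H.ite_inShape (k := k) (r := k + 1) (h := m - (k + 1)) (by omega) hk0
      (by omega) (by omega) v
    rcases Int.emod_two_eq_zero_or_one (y - k) with hy | hy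
    · have c1 : ¬ (y - 1 - k) % 2 = 0 := by omega
      have c2 : ¬ (y + 1 - k) % 2 = 0 := by omega
      have c3 : (x - 1 - n - k) % 2 = 1 := by omega
      have c4 : (x + 1 - n - k) % 2 = 1 := by omega
      simp only [InRegion, InCells, hpar, c1, c2, c3, c4, hy, true_and, and_false, false_and,
        if_false, zero_add]
      rw [e1, e2, e3, e3]
      have b := @box_shrink_horizontal (n - k) (m - k) x y (by omega) (by omega) (by omega)
      have t := fun i => @vertexTerm_add_horizontal k (a i) (x - e i) y
        (by have := H.parity i; omega) hy
      have t' := sum_congr (rfl : (univ : Finset (Fin s)) = univ) fun i _ => t i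
      rw [sum_add_distrib, sum_add_distrib] at t'
      simp only [vertexTerm, cellTerm] at t'
      simp only [← sub_sub, sub_right_comm _ _ (1 : ℤ), add_sub_right_comm] at b t' ⊢
      linarith
    · have c1 : (y - 1 - k) % 2 = 0 := by omega
      have c2 : (y + 1 - k) % 2 = 0 := by omega
      have c3 : (x - n - k) % 2 = 1 := by omega
      have c4 : ¬ (y - k) % 2 = 0 := by omega
      simp only [InRegion, InCells, hpar, c1, c2, c3, c4, true_and, and_false, false_and,
        if_false, add_zero]
      rw [e1, e2, e3, e3]
      have b := @box_shrink_vertical (n - k) (m - k) x y (by omega) (by omega) (by omega)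
      have t := fun i => @vertexTerm_add_vertical k (a i) (x - e i) y hk0
        (by have := H.parity i; omega) hy
      have t' := sum_congr (rfl : (univ : Finset (Fin s)) = univ) fun i _ => t i
      rw [sum_add_distrib, sum_add_distrib] at t'
      simp only [vertexTerm, cellTerm] at t'
      simp only [← sub_sub] at b t' ⊢
      linarith
  · have c1 : ¬ ((x - n - k) % 2 = 1 ∧ (y - 1 - k) % 2 = 0) := by omega
    have c2 : ¬ ((x - n - k) % 2 = 1 ∧ (y + 1 - k) % 2 = 0) := by omega
    have c3 : ¬ ((x - 1 - n - k) % 2 = 1 ∧ (y - k) % 2 = 0) := by omega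
    have c4 : ¬ ((x + 1 - n - k) % 2 = 1 ∧ (y - k) % 2 = 0) := by omega
    simp only [InRegion, InCells, hpar, c1, c2, c3, c4, false_and, if_false]
    rfl

lemma Placement.edge_inCells {m k : ℤ} (hk : k + 1 ≤ K) (hm : 2 * K < m)
    (hm1 : m % 2 = 1) {x y x' y' : ℤ} (hx : x' - x = 1 ∨ x - x' = 1) (hy : y' - y = 1 ∨ y - y' = 1)
    (hxp : (x - n - k) % 2 = 1) (hyp : (y - k) % 2 = 1)
    (hR : (InRegion n m k a e (x, y) ∧ InRegion n m k a e (x', y')) ∨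
      (InRegion n m (k + 1) a e (x, y) ∧ InRegion n m (k + 1) a e (x', y'))) :
    InCells n m k a e (x, y') := by
  have hK := H.le_width
  refine ⟨⟨hxp, by dsimp only; omega⟩, ?_, ?_⟩
  -- Parity sharpens each bound on an end of the edge by one wherever it is not already attained by
  -- the centre, which shares its column with one end and its row with the other.
  · rcases hR with ⟨⟨-, h1, -⟩, ⟨-, h2, -⟩⟩ | ⟨⟨-, h1, -⟩, ⟨-, h2, -⟩⟩
    · simp only [abs_le] at h1 h2 ⊢
      rcases h2 with h2 | ⟨i, h2⟩
      · rcases h1 with h1 | ⟨i, h1⟩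
        · left; omega
        · right; exact ⟨i, by omega⟩
      · clear h1
        right
        have := H.parity i
        exact ⟨i, by omega⟩
    · rcases h1 with h1 | ⟨i, h1⟩
      · left
        rcases h2 with h2 | ⟨i, h2⟩ <;> simp only [abs_le] at h1 h2 ⊢ <;> omega
      · right
        have o1 := H.protrusion_outside hk h1.1
        have := H.parity i
        refine ⟨i, ?_⟩
        rcases h2 with h2 | ⟨j, h2⟩ <;> simp only [abs_le] at h1 h2 ⊢ <;> omega
  · rintro ⟨i, hi⟩
    rcases hR with ⟨⟨-, -, -⟩, ⟨-, -, h2⟩⟩ | ⟨⟨-, -, h1⟩, ⟨-, -, -⟩⟩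
    · refine h2 ⟨i, ?_⟩
      simp only [abs_le] at hi ⊢
      omega
    · refine h1 ⟨i, ?_⟩
      simp only [abs_le] at hi ⊢
      omega

end

lemma load_one (C : Finset Cell) (x y : ℤ) : (load C (fun _ _ => 1) (x, y) : ℤ) =
    (if (x, y - 1) ∈ C then 1 else 0) + (if (x, y + 1) ∈ C then 1 else 0) +
      (if (x - 1, y) ∈ C then 1 else 0) + (if (x + 1, y) ∈ C then 1 else 0) := by
  have h : ∀ p : Cell, (if p ∈ C then 1 else 0 : ℤ) = ∑ c : C, if (c : Cell) = p then 1 else 0 := by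
    intro p
    rw [sum_coe_sort C fun c => if c = p then (1 : ℤ) else 0]
    simp
  have e1 : ∀ c : Cell, (c.1, c.2 + 1) = (x, y) ↔ c = (x, y - 1) := by
    rintro ⟨c, d⟩; simp; omega
  have e2 : ∀ c : Cell, (c.1 + 1, c.2) = (x, y) ↔ c = (x - 1, y) := by
    rintro ⟨c, d⟩; simp; omega
  have e3 : ∀ c : Cell, (c.1, c.2 - 1) = (x, y) ↔ c = (x, y + 1) := by
    rintro ⟨c, d⟩; simp; omega
  have e4 : ∀ c : Cell, (c.1 - 1, c.2) = (x, y) ↔ c = (x + 1, y) := by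
    rintro ⟨c, d⟩; simp; omega
  rw [h, h, h, h, load, ← sum_add_distrib, ← sum_add_distrib, ← sum_add_distrib]
  push_cast
  refine sum_congr rfl fun c _ => ?_
  rw [Fin.sum_univ_four]
  simp only [corner, Matrix.cons_val, e1, e2, e3, e4]
  ring

/-- Complementation between the regions at heights `k` and `k + 1`. -/
lemma Placement.numTilings_step {s : ℕ} {n K m k : ℤ} {a e : Fin s → ℤ} (H : Placement n K a e)
    (hk : k + 1 ≤ K) (hk0 : 0 ≤ k) (hm : 2 * K < m) (hm1 : m % 2 = 1) {R R' : Finset Cell}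
    (hR : ∀ v, v ∈ R ↔ InRegion n m k a e v) (hR' : ∀ v, v ∈ R' ↔ InRegion n m (k + 1) a e v)
    {q : ℝ} (hq : q ^ 4 = 2) :
    numTilings R' * q ^ #R = numTilings R * q ^ #R' := by
  classical
  have hK := H.le_width
  obtain ⟨C, hC⟩ : ∃ C : Finset Cell, ∀ c, c ∈ C ↔ InCells n m k a e c := by
    -- Any bounding box will do; protrusions extend less than `m` beyond their centres, which lie in
    -- `[-n, n]`.
    refine ⟨(Icc (-(n + m)) (n + m) ×ˢ Icc (-m) m).filter fun c => InCells n m k a e c,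
      fun c => ?_⟩
    rw [mem_filter, and_iff_right_iff_imp]
    rintro ⟨-, ⟨h1, h2⟩ | ⟨i, h1, h2⟩, -⟩
    · rw [abs_le] at h1 h2
      simp only [mem_product, mem_Icc]
      omega
    · have := H.left_le i
      have := H.le_right i
      have := H.nonneg i
      rw [abs_le] at h1 h2
      dsimp only at h1
      simp only [mem_product, mem_Icc]
      omega
  have hedge : ∀ {Q : Finset Cell} {j : ℤ}, (j = k ∨ j = k + 1) →
      (∀ v, v ∈ Q ↔ InRegion n m j a e v) →
      ∀ p ∈ Q, ∀ q ∈ Q, diagGrid.Adj p q → (p.1, q.2) ∈ C ∨ (q.1, p.2) ∈ C := by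
    rintro Q j hj hQ ⟨x, y⟩ hp ⟨x', y'⟩ hp' ⟨h1, h2⟩
    rw [abs_eq zero_le_one] at h1 h2
    rw [hQ] at hp hp'
    rw [hC, hC]
    dsimp only at h1 h2 ⊢
    have w1 := hp.1
    have w2 := hp'.1
    dsimp only at w1 w2
    rcases Int.emod_two_eq_zero_or_one (y - k) with hy | hy
    · right
      refine H.edge_inCells hk hm hm1 (x' := x) (y' := y) (x := x') (y := y') (by omega)
        (by omega) (by omega) (by omega) ?_
      rcases hj with rfl | rfl
      exacts [Or.inl ⟨hp', hp⟩, Or.inr ⟨hp', hp⟩]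
    · left
      refine H.edge_inCells hk hm hm1 (x' := x') (y' := y') (x := x) (y := y) (by omega)
        (by omega) (by omega) (by omega) ?_
      rcases hj with rfl | rfl
      exacts [Or.inl ⟨hp, hp'⟩, Or.inr ⟨hp, hp'⟩]
  refine numTilings_complement (C := C) ?_ (hedge (Or.inl rfl) hR) (hedge (Or.inr rfl) hR') ?_ hq
  · intro c hc c' hc'
    obtain ⟨⟨h1, h2⟩, -⟩ := (hC c).mp hc
    obtain ⟨⟨h3, h4⟩, -⟩ := (hC c').mp hc'
    rw [Int.even_iff, Int.even_iff]
    omega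
  · rintro ⟨x, y⟩
    have := H.region_add_region hk hk0 hm hm1 x y
    zify
    rw [load_one]
    simp only [hC, hR, hR']
    exact this

/-! ### Perfect matchings as tilings -/

lemma numMatchings_dualGraph (R : Finset Cell) : numMatchings (dualGraph R) = numTilings R := by
  classical
  let f : (dualGraph R).Subgraph → Finset (Finset Cell) := fun M =>
    R.powerset.filter fun D => ∃ u v, M.Adj u v ∧ D = {u.1, v.1}
  have hf : ∀ M D, D ∈ f M ↔ ∃ u v, M.Adj u v ∧ D = {u.1, v.1} := by
    intro M D
    simp only [f, mem_filter, mem_powerset, and_iff_right_iff_imp]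
    rintro ⟨u, v, -, rfl⟩ x hx
    rw [mem_insert, mem_singleton] at hx
    rcases hx with rfl | rfl
    exacts [u.2, v.2]
  have hadj : ∀ (M : (dualGraph R).Subgraph) u v, M.Adj u v ↔ {u.1, v.1} ∈ f M := by
    intro M u v
    rw [hf]
    refine ⟨fun h => ⟨u, v, h, rfl⟩, ?_⟩
    rintro ⟨u', v', h, he⟩
    rcases pair_eq_pair he with ⟨h1, h2⟩ | ⟨h1, h2⟩
    · rwa [Subtype.ext h1, Subtype.ext h2]
    · rw [Subtype.ext h1, Subtype.ext h2]
      exact h.symm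
  have hinj : Set.InjOn f {M | M.IsPerfectMatching} := by
    intro M hM M' hM' h
    refine SimpleGraph.Subgraph.ext ?_ ?_
    · rw [SimpleGraph.Subgraph.isSpanning_iff.mp hM.2, SimpleGraph.Subgraph.isSpanning_iff.mp hM'.2]
    · ext u v
      rw [hadj, h, hadj]
  rw [numMatchings, numTilings, ← hinj.ncard_image]
  congr 1
  ext P
  simp only [Set.mem_image, Set.mem_ofPred_eq]
  constructor
  · rintro ⟨M, ⟨hM, hs⟩, rfl⟩
    refine ⟨?_, ?_, ?_⟩
    · intro D hD
      obtain ⟨u, v, h, rfl⟩ := (hf M D).mp hD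
      exact ⟨_, _, M.adj_sub h, rfl⟩
    · have key : ∀ D ∈ f M, ∀ x ∈ D, ∃ hx : x ∈ R, ∃ v, M.Adj ⟨x, hx⟩ v ∧ D = {x, v.1} := by
        intro D hD x hx
        obtain ⟨u, v, h, rfl⟩ := (hf M D).mp hD
        rw [mem_insert, mem_singleton] at hx
        rcases hx with rfl | rfl
        · exact ⟨u.2, v, h, rfl⟩
        · exact ⟨v.2, u, h.symm, pair_comm _ _⟩
      intro D hD D' hD' hne
      refine Finset.disjoint_left.mpr fun x hx hx' => hne ?_
      obtain ⟨hxR, v, h, h1⟩ := key D hD x hx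
      obtain ⟨_, v', h', h2⟩ := key D' hD' x hx'
      rw [h1, h2, (hM (hs ⟨x, hxR⟩)).unique h h']
    · ext x
      simp only [mem_biUnion, id]
      constructor
      · rintro ⟨D, hD, hx⟩
        exact mem_powerset.mp (mem_filter.mp hD).1 hx
      · intro hx
        obtain ⟨v, hv, -⟩ := hM (hs ⟨x, hx⟩)
        exact ⟨_, (hf M _).mpr ⟨_, _, hv, rfl⟩, mem_insert_self _ _⟩
  · intro hP
    let M : (dualGraph R).Subgraph :=
      { verts := Set.univ
        Adj := fun u v => {u.1, v.1} ∈ P ∧ diagGrid.Adj u.1 v.1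
        adj_sub := fun h => h.2
        edge_vert := fun _ => Set.mem_univ _
        symm := ⟨fun u v h => ⟨by rw [pair_comm]; exact h.1, h.2.symm⟩⟩ }
    have hdom : ∀ D ∈ P, ∀ x ∈ D, ∃ y ∈ R, diagGrid.Adj x y ∧ D = {x, y} := by
      intro D hD x hx
      have hsub : D ⊆ R := by
        rw [← hP.2.2]
        exact subset_biUnion_of_mem id hD
      obtain ⟨p, q, h, rfl⟩ := hP.1 D hD
      rw [mem_insert, mem_singleton] at hx
      rcases hx with rfl | rfl
      · exact ⟨q, hsub (by simp), h, rfl⟩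
      · exact ⟨p, hsub (by simp), h.symm, pair_comm _ _⟩
    refine ⟨M, ⟨?_, fun _ => Set.mem_univ _⟩, ?_⟩
    · rintro ⟨x, hx⟩ -
      have hx' := hx
      rw [← hP.2.2] at hx'
      obtain ⟨D, hD, hxD⟩ := mem_biUnion.mp hx'
      obtain ⟨y, hy, hxy, rfl⟩ := hdom D hD x hxD
      refine ⟨⟨y, hy⟩, ⟨hD, hxy⟩, ?_⟩
      rintro ⟨z, hz⟩ ⟨hz1, hz2⟩
      by_contra hne
      refine Finset.disjoint_left.mp (hP.2.1 hD hz1 fun h => hne ?_) hxD (mem_insert_self x {z})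
      rcases pair_eq_pair h with ⟨-, h⟩ | ⟨h, -⟩
      · exact Subtype.ext h.symm
      · exact absurd h hz2.ne
    · ext D
      rw [hf]
      constructor
      · rintro ⟨u, v, ⟨h, -⟩, rfl⟩
        exact h
      · intro hD
        have hsub : D ⊆ R := by
          rw [← hP.2.2]
          exact subset_biUnion_of_mem id hD
        obtain ⟨p, q, h, rfl⟩ := hP.1 D hD
        exact ⟨⟨p, hsub (by simp)⟩, ⟨q, hsub (by simp)⟩, ⟨hD, h⟩, rfl⟩

/-! ### The regions of the theorem and their numbers of vertices -/

lemma mem_aztecRect {h w : ℕ} {c p : Cell} : p ∈ aztecRect h w c ↔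
    |p.1 - c.1| ≤ w ∧ |p.2 - c.2| ≤ h ∧ (p.1 - c.1 + w + (p.2 - c.2 + h)) % 2 = 1 := by
  simp only [aztecRect, board, IsBlack, mem_filter, mem_product, mem_Icc, abs_le, Int.even_iff]
  omega

lemma mem_oddAztecRect {h w : ℕ} {c p : Cell} : p ∈ oddAztecRect h w c ↔
    |p.1 - c.1| ≤ w ∧ |p.2 - c.2| ≤ h ∧ (p.1 - c.1 + w + (p.2 - c.2 + h)) % 2 = 0 := by
  simp only [oddAztecRect, board, IsBlack, mem_filter, mem_product, mem_Icc, abs_le, Int.even_iff]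
  omega

lemma card_doubled_grid (f g : ℕ) (p : Cell) :
    #((range f ×ˢ range g).image fun i => ((p.1 + 2 * i.1, p.2 + 2 * i.2) : Cell)) = f * g := by
  rw [card_image_of_injective, card_product, card_range, card_range]
  rintro ⟨i, j⟩ ⟨i', j'⟩ h
  simp only [Prod.mk.injEq] at h ⊢
  omega

lemma mem_doubled_grid {f g : ℕ} {p v : Cell} :
    v ∈ ((range f ×ˢ range g).image fun i => ((p.1 + 2 * i.1, p.2 + 2 * i.2) : Cell)) ↔
      (p.1 ≤ v.1 ∧ v.1 < p.1 + 2 * f ∧ (v.1 - p.1) % 2 = 0) ∧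
        p.2 ≤ v.2 ∧ v.2 < p.2 + 2 * g ∧ (v.2 - p.2) % 2 = 0 := by
  obtain ⟨x, y⟩ := v
  simp only [mem_image, mem_product, mem_range, Prod.mk.injEq, Prod.exists]
  constructor
  · rintro ⟨i, j, h1, h2, h3⟩
    omega
  · intro h
    exact ⟨((x - p.1) / 2).toNat, ((y - p.2) / 2).toNat, by omega⟩

lemma card_aztecRect (h w : ℕ) (c : Cell) : #(aztecRect h w c) = w * (h + 1) + (w + 1) * h := by
  rw [← card_doubled_grid w (h + 1) (c.1 - w + 1, c.2 - h),
    ← card_doubled_grid (w + 1) h (c.1 - w, c.2 - h + 1), ← card_union_of_disjoint]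
  · congr 1
    ext v
    rw [mem_union, mem_doubled_grid, mem_doubled_grid, mem_aztecRect, abs_le, abs_le]
    push_cast
    omega
  · refine Finset.disjoint_left.mpr fun v h1 h2 => ?_
    rw [mem_doubled_grid] at h1 h2
    dsimp only at h1 h2
    omega

lemma card_oddAztecRect (h w : ℕ) (c : Cell) :
    #(oddAztecRect h w c) = w * h + (w + 1) * (h + 1) := by
  rw [← card_doubled_grid w h (c.1 - w + 1, c.2 - h + 1),
    ← card_doubled_grid (w + 1) (h + 1) (c.1 - w, c.2 - h), ← card_union_of_disjoint]
  · congr 1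
    ext v
    rw [mem_union, mem_doubled_grid, mem_doubled_grid, mem_oddAztecRect, abs_le, abs_le]
    push_cast
    omega
  · refine Finset.disjoint_left.mpr fun v h1 h2 => ?_
    rw [mem_doubled_grid] at h1 h2
    dsimp only at h1 h2
    omega

section
variable {s m t K : ℕ} {a : Fin s → ℕ} {d : Fin s → ℤ}
  (H : Placement ((m - t : ℕ) : ℤ) K (fun i => (a i : ℤ)) fun i => d i - 2 - (m - t : ℕ))
include H

/-- The conditions on `i` in the two unions can be dropped: for the other indices the half-width is
negative, and the inequality defining the rectangle has no solution. -/
lemma Placement.mem_protrudedRegion {k : ℕ} (hk : k ≤ K) (hm : 2 * K < m) (hodd : m % 2 = 1)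
    (v : Cell) : v ∈ protrudedRegion m t k a d ↔ InRegion ((m - t : ℕ) : ℤ) m k
      (fun i => (a i : ℤ)) (fun i => d i - 2 - (m - t : ℕ)) v := by
  have hK := H.le_width
  simp only [protrudedRegion, protrusions, windows, mem_sdiff, mem_union, mem_biUnion, mem_filter,
    mem_univ, true_and, mem_aztecRect, mem_oddAztecRect, InRegion, InShape, axisPoint, sub_zero]
  have hpar := H.parity
  have e0 : ((m - k - t : ℕ) : ℤ) = ((m - t : ℕ) : ℤ) - k := by omega
  have e0' : ((m - k : ℕ) : ℤ) = (m : ℤ) - k := by omega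
  rw [e0, e0']
  generalize ((m - t : ℕ) : ℤ) = n at *
  by_cases hv : (v.1 + v.2 - n) % 2 = 0
  · simp only [hv, true_and]
    refine and_congr (or_congr ?_ (exists_congr fun i => ?_))
      (not_congr (exists_congr fun i => ?_))
    · omega
    · have := hpar i
      simp only [abs_le]
      omega
    · have := hpar i
      simp only [abs_le]
      omega
  · simp only [hv, false_and, iff_false, not_and, not_not]
    rintro (h | ⟨i, h⟩)
    · omega
    · have := hpar i
      omega

/-- Removing a window and adding a protrusion change the count by the same polynomial in `k` and `a
i`, so no case distinction survives. -/
lemma Placement.card_protrudedRegion {k : ℕ} (hk : k ≤ K) (hm : 2 * K < m)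
    (hodd : m % 2 = 1) : (#(protrudedRegion m t k a d) : ℤ) =
      2 * (m - k) * ((m - t : ℕ) - k) + m + (m - t : ℕ) - 2 * k -
        ∑ i, (2 * k * (a i - k) + a i + 1 : ℤ) := by
  have hK := H.le_width
  have hP : #(protrusions (m - t) k a d {i | a i < k}) =
      ∑ i with a i < k, #(aztecRect k (k - a i - 1) (axisPoint (m - t) (d i))) := by
    refine card_biUnion fun i hi j hj hne => Finset.disjoint_left.mpr fun v h1 h2 => hne ?_
    rw [mem_aztecRect] at h1 h2
    simp only [coe_filter, Set.mem_ofPred_eq, mem_univ, true_and, axisPoint] at hi hj h1 h2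
    exact H.protrusion_unique (k := k) (x := v.1) (by omega) (h1.1.trans (by omega))
      (h2.1.trans (by omega))
  have hW : #(windows (m - t) k a d {i | k ≤ a i}) =
      ∑ i with k ≤ a i, #(oddAztecRect k (a i - k) (axisPoint (m - t) (d i))) := by
    refine card_biUnion fun i hi j hj hne => Finset.disjoint_left.mpr fun v h1 h2 => hne ?_
    rw [mem_oddAztecRect] at h1 h2
    simp only [coe_filter, Set.mem_ofPred_eq, mem_univ, true_and, axisPoint] at hi hj h1 h2
    exact H.window_unique (r := k) (x := v.1) (by omega) (h1.1.trans (by omega))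
      (h2.1.trans (by omega))
  have hsub : windows (m - t) k a d {i | k ≤ a i} ⊆ aztecRect (m - k) (m - k - t) (0, 0) := by
    intro v hv
    simp only [windows, mem_biUnion, mem_filter, mem_univ, true_and, mem_oddAztecRect,
      axisPoint] at hv
    obtain ⟨i, hi, h1, h2, h3⟩ := hv
    have := H.window_inside (r := k) (x := v.1) (i := i) (h1.trans (by omega))
    have := H.parity i
    rw [mem_aztecRect]
    dsimp only
    rw [sub_zero, sub_zero] at *
    omega
  have hdis : Disjoint (aztecRect (m - k) (m - k - t) (0, 0))
      (protrusions (m - t) k a d {i | a i < k}) := by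
    refine Finset.disjoint_left.mpr fun v hv hp => ?_
    simp only [protrusions, mem_biUnion, mem_filter, mem_univ, true_and, mem_aztecRect,
      axisPoint] at hp
    obtain ⟨i, hi, h1, -⟩ := hp
    have := H.protrusion_outside (k := k) (x := v.1) (i := i) (by omega) (h1.trans (by omega))
    rw [mem_aztecRect] at hv
    simp only [sub_zero, abs_le] at hv
    omega
  rw [protrudedRegion, card_sdiff_of_subset (hsub.trans subset_union_left), Nat.cast_sub
    (card_le_card (hsub.trans subset_union_left)), card_union_of_disjoint hdis, hP, hW,
    card_aztecRect, ← sum_filter_add_sum_filter_not univ (fun i => a i < k)]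
  simp only [card_aztecRect, card_oddAztecRect, not_lt]
  push_cast
  have e1 : ∀ i ∈ ({i | a i < k} : Finset (Fin s)),
      (((k - a i - 1 : ℕ) : ℤ) * (k + 1) + (((k - a i - 1 : ℕ) : ℤ) + 1) * k) =
        -(2 * k * (a i - k) + a i + 1) := by
    intro i hi
    have hi : a i < k := by simpa using hi
    have : ((k - a i - 1 : ℕ) : ℤ) = k - a i - 1 := by omega
    rw [this]
    ring
  have e2 : ∀ i ∈ ({i | k ≤ a i} : Finset (Fin s)),
      (((a i - k : ℕ) : ℤ) * k + (((a i - k : ℕ) : ℤ) + 1) * (k + 1)) =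
        2 * k * (a i - k) + a i + 1 := by
    intro i hi
    have hi : k ≤ a i := by simpa using hi
    rw [Nat.cast_sub hi]
    ring
  rw [sum_congr rfl e1, sum_congr rfl e2, sum_neg_distrib]
  have e3 : ((m - k - t : ℕ) : ℤ) = ((m - t : ℕ) : ℤ) - k := by omega
  have e4 : ((m - k : ℕ) : ℤ) = (m : ℤ) - k := by omega
  rw [e3, e4]
  ring

/-! ### Iteration over the height -/

lemma Placement.numTilings_protrudedRegion (hm : 2 * K < m) (hodd : m % 2 = 1) {q : ℝ}
    (hq : q ^ 4 = 2) {k : ℕ} (hk : k ≤ K) :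
    numTilings (protrudedRegion m t k a d) * q ^ #(protrudedRegion m t 0 a d) =
      numTilings (protrudedRegion m t 0 a d) * q ^ #(protrudedRegion m t k a d) := by
  have hq0 : q ≠ 0 := by
    rintro rfl
    norm_num at hq
  induction k with
  | zero => rfl
  | succ k ih =>
    have h := H.numTilings_step (m := m) (k := k) (by omega) (by omega) (by omega) (by omega)
      (H.mem_protrudedRegion (by omega) hm hodd)
      (by
        have := H.mem_protrudedRegion hk hm hodd
        push_cast at this
        exact this) hq
    have ih := ih (by omega)
    refine mul_right_cancel₀ (pow_ne_zero #(protrudedRegion m t k a d) hq0) ?_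
    linear_combination q ^ #(protrudedRegion m t 0 a d) * h +
      q ^ #(protrudedRegion m t (k + 1) a d) * ih

lemma Placement.numTilings_protrudedRegion_eq (ht : t = ∑ i, (a i + 1)) (htm : t < m)
    (hm : 2 * K < m) (hodd : m % 2 = 1) : (numTilings (protrudedRegion m t K a d) : ℚ) =
      2 ^ (((K + 1).choose 2 : ℤ) * (s + 1) - K * (m + 1)) *
        numTilings (protrudedRegion m t 0 a d) := by
  obtain ⟨q, hq0, hq⟩ : ∃ q : ℝ, 0 < q ∧ q ^ 4 = 2 :=
    ⟨2 ^ (1 / 4 : ℝ), by positivity, by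
      rw [← Real.rpow_natCast, ← Real.rpow_mul (by norm_num)]; norm_num⟩
  have h := H.numTilings_protrudedRegion hm hodd hq le_rfl
  -- Here `t = ∑ i, (a i + 1)` is used: it makes the difference of the counts divisible by 4, so
  -- that `q` disappears.
  have hc : #(protrudedRegion m t K a d) + 4 * (K * (m + 1)) =
      #(protrudedRegion m t 0 a d) + 4 * ((K + 1).choose 2 * (s + 1)) := by
    have h1 := H.card_protrudedRegion le_rfl hm hodd
    have h0 := H.card_protrudedRegion (Nat.zero_le K) hm hodd
    have h2 : ((K + 1).choose 2 : ℤ) * 2 = (K + 1) * K := by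
      have := Nat.choose_two_right (K + 1)
      have := Nat.div_mul_cancel (Nat.even_mul_pred_self (K + 1)).two_dvd
      rw [← Nat.choose_two_right, Nat.add_sub_cancel] at this
      exact_mod_cast this
    zify
    rw [h1, h0, Nat.cast_sub htm.le, ht]
    push_cast
    simp only [sum_add_distrib, ← mul_sum, sum_sub_distrib, sum_const, card_univ, Fintype.card_fin,
      nsmul_eq_mul]
    linear_combination (-2 * (s + 1 : ℤ)) * h2
  have key : numTilings (protrudedRegion m t K a d) * 2 ^ (K * (m + 1)) =
      numTilings (protrudedRegion m t 0 a d) * 2 ^ ((K + 1).choose 2 * (s + 1)) := by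
    have h3 := congrArg (fun i => q ^ i) hc
    simp only [pow_add, pow_mul _ 4, hq] at h3
    have : (numTilings (protrudedRegion m t K a d) * 2 ^ (K * (m + 1)) : ℝ) =
        numTilings (protrudedRegion m t 0 a d) * 2 ^ ((K + 1).choose 2 * (s + 1)) := by
      refine mul_right_cancel₀ (pow_ne_zero #(protrudedRegion m t 0 a d) hq0.ne') ?_
      linear_combination 2 ^ (K * (m + 1)) * h + numTilings (protrudedRegion m t 0 a d) * h3
    exact_mod_cast this
  have key' : (numTilings (protrudedRegion m t K a d) * 2 ^ (K * (m + 1)) : ℚ) =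
      numTilings (protrudedRegion m t 0 a d) * 2 ^ ((K + 1).choose 2 * (s + 1)) := by
    exact_mod_cast key
  rw [zpow_sub₀ two_ne_zero, div_mul_eq_mul_div, eq_div_iff (by positivity)]
  have e1 : (2 : ℚ) ^ ((K : ℤ) * (m + 1)) = 2 ^ (K * (m + 1)) := by
    rw [← zpow_natCast]
    push_cast
    rfl
  have e2 : (2 : ℚ) ^ (((K + 1).choose 2 : ℤ) * (s + 1)) = 2 ^ ((K + 1).choose 2 * (s + 1)) := by
    rw [← zpow_natCast]
    push_cast
    rfl
  rw [e1, e2, key', mul_comm]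

end

/-! ### Translation from runs of labels -/

lemma protrudedRegion_eq_windowedRegion {s : ℕ} (m t k : ℕ) (a : Fin s → ℕ) (d : Fin s → ℤ)
    (h : ∀ i, k ≤ a i) : protrudedRegion m t k a d = windowedRegion m t k a d := by
  have h1 : (univ.filter fun i => a i < k) = ∅ := by simp [filter_eq_empty_iff, h]
  have h2 : (univ.filter fun i => k ≤ a i) = univ := by simp [h]
  rw [protrudedRegion, h1, h2, windowedRegion, protrusions, biUnion_empty, union_empty]

/-- Disjoint runs of total size `t` fit among the `m - t + 1` labels. With `2 * K < m` this gives `K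
≤ m - t`, so the frame does not shrink away. -/
lemma sum_runs_le {m s t : ℕ} {a : Fin s → ℕ} {d : Fin s → ℤ}
    (ht : t = ∑ i, (a i + 1)) (htm : t < m) (hpar : ∀ i, Even (d i - a i))
    (hframe : ∀ i, run (a i) (d i) ⊆ Icc (1 : ℤ) (m - t + 1))
    (hdisj : Pairwise fun i j => Disjoint (run (a i) (d i)) (run (a j) (d j))) :
    t ≤ m - t + 1 := by
  have h1 := card_le_card (biUnion_subset.mpr fun i (_ : i ∈ univ) => hframe i)
  rw [card_biUnion fun i _ j _ hne => hdisj hne] at h1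
  have h2 : ∀ i, #(run (a i) (d i)) = a i + 1 := by
    intro i
    obtain ⟨r, hr⟩ := hpar i
    rw [run, Int.card_Icc]
    omega
  rw [sum_congr rfl fun i _ => h2 i, ← ht, Int.card_Icc] at h1
  omega

/-- Runs contained in an interval and pairwise disjoint give a placement. -/
lemma placement_of_runs {m s K t : ℕ} {a : Fin s → ℕ} {d : Fin s → ℤ}
    (ht : t = ∑ i, (a i + 1)) (htm : t < m) (hm : 2 * K < m) (hpar : ∀ i, Even (d i - a i))
    (hframe : ∀ i, run (a i) (d i) ⊆ Icc (1 : ℤ) (m - t + 1))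
    (hdisj : Pairwise fun i j => Disjoint (run (a i) (d i)) (run (a j) (d j)))
    (htouch : ∀ i, K ≤ a i ∨ (1 : ℤ) ∈ run (a i) (d i) ∨ (m - t + 1 : ℤ) ∈ run (a i) (d i)) :
    Placement ((m - t : ℕ) : ℤ) K (fun i => (a i : ℤ)) fun i => d i - 2 - (m - t : ℕ) := by
  have hb : ∀ i, 1 ≤ (d i - a i) / 2 ∧ (d i + a i) / 2 ≤ m - t + 1 := by
    intro i
    have := hframe i
    rw [run, Icc_subset_Icc_iff (by omega)] at this
    exact this
  have hcard := sum_runs_le ht htm hpar hframe hdisj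
  refine ⟨fun i => by omega, fun i => ?_, fun i => ?_, fun i => ?_, fun i j hne => ?_,
    fun i hi => ?_, by omega⟩
  · have := Int.even_iff.mp (hpar i)
    omega
  · have := Int.even_iff.mp (hpar i)
    have := hb i
    omega
  · have := Int.even_iff.mp (hpar i)
    have := hb i
    omega
  · have := Int.even_iff.mp (hpar i)
    have := Int.even_iff.mp (hpar j)
    have hd := hdisj hne
    -- If two integer intervals meet, the larger of their left ends lies in both.
    have h1 : max ((d i - a i) / 2) ((d j - a j) / 2) ∉ run (a i) (d i) ∨
        max ((d i - a i) / 2) ((d j - a j) / 2) ∉ run (a j) (d j) := by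
      by_contra! h
      exact Finset.disjoint_left.mp hd h.1 h.2
    simp only [run, mem_Icc] at h1
    omega
  · have := Int.even_iff.mp (hpar i)
    have := hb i
    have := htouch i
    simp only [run, mem_Icc] at this
    omega

lemma vertsR''_eq_windowedRegion {m s t : ℕ} {a : Fin s → ℕ} {d : Fin s → ℤ} (htm : t < m)
    (hpar : ∀ i, Even (d i - a i)) (hframe : ∀ i, run (a i) (d i) ⊆ Icc (1 : ℤ) (m - t + 1)) :
    vertsR'' m (m - t) (Icc (1 : ℤ) (m - t + 1) \ univ.biUnion fun i => run (a i) (d i)) =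
      windowedRegion m t 0 a d := by
  rw [vertsR'', windowedRegion, Nat.sub_zero, Nat.cast_sub htm.le,
    Finset.sdiff_sdiff_eq_self (biUnion_subset.mpr fun i _ => hframe i)]
  congr 1
  ext ⟨x, y⟩
  simp only [windows, mem_image, mem_biUnion, mem_univ, true_and, run, mem_Icc, mem_oddAztecRect,
    axisPoint, Prod.mk.injEq, abs_le]
  constructor
  · rintro ⟨τ, ⟨i, hi⟩, hx, hy⟩
    have := Int.even_iff.mp (hpar i)
    exact ⟨i, by omega⟩
  · rintro ⟨i, hi⟩
    have := Int.even_iff.mp (hpar i)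
    exact ⟨(x + 2 + (m - t : ℕ)) / 2, ⟨i, by omega⟩, by omega, by omega⟩

lemma cruciform_sdiff_eq_protrudedRegion {m s k t : ℕ} {a : Fin s → ℕ} {d : Fin s → ℤ}
    (H : Placement ((m - t : ℕ) : ℤ) k (fun i => (a i : ℤ)) fun i => d i - 2 - (m - t : ℕ))
    (hodd : m % 2 = 1) (hm : 2 * k < m) {l r : Fin s}
    (hl : d l - a l = 2) (hr : d r + a r = 2 * (m - t : ℕ) + 2) (hlk : a l < k) (hrk : a r < k)
    (hk : ∀ i, i ≠ l → i ≠ r → k ≤ a i) :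
    cruciform (m - t - k) k ((m - 1) / 2 - k) (k - a r - 1) ((m - 1) / 2 - k) (k - a l - 1) \
        windows (m - t) k a d (univ.filter fun i => i ≠ l ∧ i ≠ r) =
      protrudedRegion m t k a d := by
  have hK := H.le_width
  have hfilter : (univ.filter fun i => i ≠ l ∧ i ≠ r) = univ.filter fun i => k ≤ a i := by
    ext i
    simp only [mem_filter, mem_univ, true_and]
    refine ⟨fun h => hk i h.1 h.2, fun h => ⟨?_, ?_⟩⟩ <;> rintro rfl <;> omega
  have hprot : (univ.filter fun i => a i < k) = {l, r} := by
    ext i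
    simp only [mem_filter, mem_univ, true_and, mem_insert, mem_singleton]
    constructor
    · intro h
      by_contra! hne
      have := hk i hne.1 hne.2
      omega
    · rintro (rfl | rfl)
      exacts [hlk, hrk]
  rw [hfilter, protrudedRegion, hprot]
  congr 1
  ext ⟨x, y⟩
  simp only [cruciform, protrusions, mem_filter, mem_union, mem_product, mem_Icc, IsBlack,
    Int.even_iff, mem_biUnion, mem_insert, mem_singleton, exists_eq_or_imp, exists_eq_left,
    mem_aztecRect, axisPoint, abs_le, sub_zero]
  have e1 : ((m - t - k : ℕ) : ℤ) = (m - t : ℕ) - k := by omega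
  have e2 : ((m - k - t : ℕ) : ℤ) = (m - t : ℕ) - k := by omega
  have e3 : ((m - k : ℕ) : ℤ) = m - k := by omega
  -- As `m` is odd, the vertical arms end at height `k + (m - 2 * k) = m - k`, that of the frame.
  have e4 : 2 * (((m - 1) / 2 - k : ℕ) : ℤ) + 1 = m - 2 * k := by omega
  have e5 : ((k - a l - 1 : ℕ) : ℤ) = k - a l - 1 := by omega
  have e6 : ((k - a r - 1 : ℕ) : ℤ) = k - a r - 1 := by omega
  rw [e1, e2, e3, e4, e5, e6]
  have f1 : d l = a l + 2 := by omega
  have f2 : d r = 2 * (m - t : ℕ) + 2 - a r := by omega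
  rw [f1, f2]
  have hoddz : (m : ℤ) % 2 = 1 := by omega
  clear hk hfilter hprot H e1 e2 e3 e4 e5 e6 f1 f2 hl hr hodd
  generalize ((m - t : ℕ) : ℤ) = n at *
  constructor
  · rintro ⟨h | h, hp⟩
    · left; omega
    · by_cases h1 : x < -(n - k)
      · right; left; omega
      · by_cases h2 : n - k < x
        · right; right; omega
        · left; omega
  · rintro (h | h | h)
    · exact ⟨Or.inl (by omega), by omega⟩
    · exact ⟨Or.inr (by omega), by omega⟩
    · exact ⟨Or.inr (by omega), by omega⟩

end AztecWindows

open AztecWindows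
theorem theorem3p3 (m s k t : ℕ) (a : Fin s → ℕ) (d : Fin s → ℤ)
    (hm : Odd m) (hs : 0 < s) (hk : 0 < k)
    -- the frame is `AR_{m,m-t}`, with `t` the total length of the windows at height `k = 0`
    (ht : t = ∑ i, (a i + 1)) (htm : t < m)
    -- the centre `c_i = d_i / 2` is an integer exactly when `a_i` is even
    (hpar : ∀ i, Even (d i - a i))
    -- the sets `A_i` of `a_i + 1` consecutive labels centred at `c_i` lie on the frame
    (hframe : ∀ i, run (a i) (d i) ⊆ Finset.Icc (1 : ℤ) (m - t + 1))
    -- and are mutually disjoint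
    (hdisj : Pairwise fun i j => Disjoint (run (a i) (d i)) (run (a j) (d j))) :
    -- windows `O_{k,a_i-k}`
    ((∀ i, k ≤ a i) →
      (numTilings (windowedRegion m t k a d) : ℚ) =
          2 ^ (((k + 1).choose 2 : ℤ) * (s + 1) - k * (m + 1)) *
            numTilings (windowedRegion m t 0 a d) ∧
      (numTilings (windowedRegion m t k a d) : ℚ) =
          2 ^ (((k + 1).choose 2 : ℤ) * (s + 1) - k * (m + 1)) *
            numMatchings (graphR'' m (m - t) (Finset.Icc (1 : ℤ) (m - t + 1) \
              Finset.univ.biUnion fun i => run (a i) (d i)))) ∧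
    -- windows that reach an end of the frame on `ℓ` may have turned into protrusions
    (2 * k < m →
      (∀ i, k ≤ a i ∨ (1 : ℤ) ∈ run (a i) (d i) ∨ (m - t + 1 : ℤ) ∈ run (a i) (d i)) →
      (numTilings (protrudedRegion m t k a d) : ℚ) =
          2 ^ (((k + 1).choose 2 : ℤ) * (s + 1) - k * (m + 1)) *
            numMatchings (graphR'' m (m - t) (Finset.Icc (1 : ℤ) (m - t + 1) \
              Finset.univ.biUnion fun i => run (a i) (d i)))) ∧
    -- cruciform regions with holes: both extreme windows have turned into protrusions
    (2 * k < m →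
      ∀ l r : Fin s, (1 : ℤ) ∈ run (a l) (d l) → (m - t + 1 : ℤ) ∈ run (a r) (d r) →
      a l < k → a r < k → (∀ i, i ≠ l → i ≠ r → k ≤ a i) →
      (numTilings (cruciform (m - t - k) k ((m - 1) / 2 - k) (k - a r - 1)
            ((m - 1) / 2 - k) (k - a l - 1) \
          windows (m - t) k a d (Finset.univ.filter fun i => i ≠ l ∧ i ≠ r)) : ℚ) =
        2 ^ (((k + 1).choose 2 : ℤ) * (s + 1) - k * (m + 1)) *
          numMatchings (graphR'' m (m - t) (Finset.Icc (1 : ℤ) (m - t + 1) \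
            Finset.univ.biUnion fun i => run (a i) (d i)))) := by
  have hodd : m % 2 = 1 := Nat.odd_iff.mp hm
  have hR : numMatchings (graphR'' m (m - t) (Finset.Icc (1 : ℤ) (m - t + 1) \
      Finset.univ.biUnion fun i => run (a i) (d i))) = numTilings (windowedRegion m t 0 a d) := by
    rw [graphR'', numMatchings_dualGraph, vertsR''_eq_windowedRegion htm hpar hframe]
  have hplace := @placement_of_runs m s k t a d ht htm
  have main : 2 * k < m →
      (∀ i, k ≤ a i ∨ (1 : ℤ) ∈ run (a i) (d i) ∨ (m - t + 1 : ℤ) ∈ run (a i) (d i)) →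
      (numTilings (protrudedRegion m t k a d) : ℚ) =
        2 ^ (((k + 1).choose 2 : ℤ) * (s + 1) - k * (m + 1)) *
          numTilings (windowedRegion m t 0 a d) := by
    intro hkm h
    rw [(hplace hkm hpar hframe hdisj h).numTilings_protrudedRegion_eq ht htm hkm hodd,
      protrudedRegion_eq_windowedRegion m t 0 a d fun _ => Nat.zero_le _]
  rw [hR]
  refine ⟨fun h => ?_, main, fun hkm l r hl hr hlk hrk h => ?_⟩
  -- In the first statement this bound is automatic: `k + 1 ≤ a 0 + 1 ≤ t` and `2 * t ≤ m + 1`.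
  · have hkm : 2 * k < m := by
      have h0 : a ⟨0, hs⟩ + 1 ≤ t := by
        rw [ht]
        exact Finset.single_le_sum (f := fun i => a i + 1) (fun _ _ => Nat.zero_le _)
          (Finset.mem_univ _)
      have h1 := h ⟨0, hs⟩
      have h2 := sum_runs_le ht htm hpar hframe hdisj
      omega
    have := main hkm fun i => Or.inl (h i)
    rw [protrudedRegion_eq_windowedRegion m t k a d h] at this
    exact ⟨this, this⟩
  · have h' : ∀ i, k ≤ a i ∨ (1 : ℤ) ∈ run (a i) (d i) ∨ (m - t + 1 : ℤ) ∈ run (a i) (d i) := by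
      intro i
      by_cases hil : i = l
      · subst hil
        exact Or.inr (Or.inl hl)
      · by_cases hir : i = r
        · subst hir
          exact Or.inr (Or.inr hr)
        · exact Or.inl (h i hil hir)
    have H := hplace hkm hpar hframe hdisj h'
    have hl1 : d l - a l = 2 := by
      have h1 := H.left_le l
      have h2 := Int.even_iff.mp (hpar l)
      simp only [run, Finset.mem_Icc] at hl
      omega
    have hr1 : d r + a r = 2 * (m - t : ℕ) + 2 := by
      have h1 := H.le_right r
      have h2 := Int.even_iff.mp (hpar r)
      simp only [run, Finset.mem_Icc] at hr
      omega
    rw [cruciform_sdiff_eq_protrudedRegion H hodd hkm hl1 hr1 hlk hrk h]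
    exact main hkm h'
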